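/- Let $G$ be a non-null graph (possibly infinite), and let $S,T\subseteq V(G)$. A path between $S$ and $T$ is a path of $G$ with one end in $S$ and the other end in $T$ (a single vertex of $S\cap T$ is such a path). The distance between two vertices is the number of edges of a shortest path of $G$ between them ($\infty$ if there is none), and the distance between two paths $P,Q$ is the minimum distance in $G$ between a vertex of $P$ and a vertex of $Q$. Then either \begin{itemize} \item there are two paths between $S$ and $T$ at distance at least $3$ from each other; or \item there exists $x\in V(G)$ such that every path between $S$ and $T$ contains a vertex at distance at most $161$ from $x$. \end{itemize} -/

import Mathlib

/-- The distance `d(X, Y)` between two sets of vertices of `G`: the least length of a path of `G`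
with one end in `X` and the other in `Y`, and `⊤` if there is no such path. -/
noncomputable def setDist {V : Type*} (G : SimpleGraph V) (X Y : Set V) : ℕ∞ :=
  ⨅ x ∈ X, ⨅ y ∈ Y, G.edist x y

/-- The path `P` of `G` is a path between `S` and `T`: it has one end in `S` and the other in `T`
(a one-vertex path is allowed when its vertex lies in both sets). -/
structure PathBetween {V : Type*} (G : SimpleGraph V) (S T : Set V) where
  /-- the end in `S` -/
  source : V
  /-- the end in `T` -/
  target : V
  source_mem : source ∈ S
  target_mem : target ∈ T
  /-- the path itself -/
  path : G.Path source target

/-- The vertex set of a path between `S` and `T`. -/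
def PathBetween.verts {V : Type*} {G : SimpleGraph V} {S T : Set V} (P : PathBetween G S T) :
    Set V :=
  {v | v ∈ (P.path : G.Walk P.source P.target).support}

/-!
Fix a shortest path between `S` and `T`, the spine, and let `r` be the distance that the two paths
have to exceed (`r = 2` in the theorem). If the ball of radius `43r + 8` about a vertex of the spine
misses some path between `S` and `T`, then that path gets from one side of the vertex to the other
inside a component of the part of `G` far from the spine, which attaches to the spine, or meets `S`
or `T`, at distance at least `39r + 9` from the vertex on either side. If no ball meets all paths,
such components overlap into a chain from `S` to `T`, and we take a cheapest one.

One path starts in the first component of the chain, the other at the start of the spine. Where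
successive components overlap, the paths swap roles: the path in the component leaves it at the end
of the overlap and continues on the spine, and the other one leaves the spine for the next component
at the start of the overlap. Components that are close to each other, or three consecutive ones that
are all close to one vertex, are instead joined away from the spine and used by the same path.

A step of the chain costs `2` if the overlap is at least `18r + 6`, and `3` otherwise. Components
whose indices differ by at least three are far apart: the component that bypasses a spot where both
attach would join them at cost `4`. Two consecutive swaps are far apart as well: otherwise the
component that bypasses them replaces both steps at cost `4`, so both overlaps are large already,
but then the first of the three components overlaps the last one by `9r + 3`, which costs only `3`.
-/

namespace CoarseMenger

open SimpleGraph

variable {V : Type*} {G : SimpleGraph V} {S T X Y : Set V} {u v x : V} {k l r : ℕ}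

/-- The vertices `u` and `v` are at distance at most `k`. The bound is a natural number, so that
chained triangle inequalities are settled by linear arithmetic. -/
def Within (G : SimpleGraph V) (k : ℕ) (u v : V) : Prop := G.edist u v ≤ k

namespace Within

theorem refl (k : ℕ) (u : V) : Within G k u u := by simp [Within]

theorem symm (h : Within G k u v) : Within G k v u := by rwa [Within, edist_comm]

theorem trans (h : Within G k u v) (h' : Within G l v x) : Within G (k + l) u x := by
  rw [Within, Nat.cast_add]
  exact SimpleGraph.edist_triangle.trans (add_le_add h h')

theorem mono (h : Within G k u v) (hkl : k ≤ l) : Within G l u v :=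
  le_trans h (Nat.cast_le.2 hkl)

theorem of_adj (h : G.Adj u v) : Within G 1 u v := (edist_eq_one_iff_adj.2 h).le

theorem of_walk (w : G.Walk u v) : Within G w.length u v := edist_le w

theorem exists_walk (h : Within G k u v) : ∃ w : G.Walk u v, w.length ≤ k := by
  obtain ⟨w, hw⟩ := exists_walk_of_edist_ne_top (ne_top_of_le_ne_top (ENat.natCast_ne_top k) h)
  exact ⟨w, Nat.cast_le.1 (hw.trans_le h)⟩

end Within

theorem lt_setDist (h : ∀ x ∈ X, ∀ y ∈ Y, ¬ Within G r x y) : r < setDist G X Y := by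
  rw [← ENat.natCast_add_one_le_iff]
  exact le_iInf₂ fun x hx => le_iInf₂ fun y hy =>
    ENat.natCast_add_one_le_iff.2 (not_le.1 (h x hx y hy))

/-- The vertex `u` is at distance at most `k` from the set `X`. -/
def Close (G : SimpleGraph V) (k : ℕ) (u : V) (X : Set V) : Prop := ∃ y ∈ X, Within G k u y

theorem Close.of_mem (k : ℕ) (h : u ∈ X) : Close G k u X := ⟨u, h, .refl k u⟩

theorem Close.mono (h : Close G k u X) (hkl : k ≤ l) : Close G l u X :=
  let ⟨y, hy, huy⟩ := h
  ⟨y, hy, huy.mono hkl⟩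

theorem Close.of_within (huv : Within G k u v) (h : Close G l v X) : Close G (k + l) u X :=
  let ⟨y, hy, hvy⟩ := h
  ⟨y, hy, huv.trans hvy⟩

/-- The sets `X` and `Y` are at distance at most `k`. -/
def Near (G : SimpleGraph V) (k : ℕ) (X Y : Set V) : Prop := ∃ x ∈ X, Close G k x Y

theorem Near.symm (h : Near G k X Y) : Near G k Y X :=
  let ⟨x, hx, y, hy, hxy⟩ := h
  ⟨y, hy, x, hx, hxy.symm⟩

theorem Near.mono (h : Near G k X Y) (hkl : k ≤ l) : Near G l X Y :=
  let ⟨x, hx, hxY⟩ := h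
  ⟨x, hx, hxY.mono hkl⟩

theorem Close.near (hu : Close G k u X) (hv : Close G l u Y) : Near G (k + l) X Y :=
  let ⟨x, hx, hux⟩ := hu
  ⟨x, hx, hv.of_within hux.symm⟩

/-- Some walk from `u` to `v` stays inside `X`. -/
def ReachableIn (G : SimpleGraph V) (X : Set V) (u v : V) : Prop :=
  ∃ w : G.Walk u v, ∀ z ∈ w.support, z ∈ X

namespace ReachableIn

theorem refl (h : u ∈ X) : ReachableIn G X u u := ⟨.nil, by simpa using h⟩

theorem of_adj (h : G.Adj u v) (hu : u ∈ X) (hv : v ∈ X) : ReachableIn G X u v :=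
  ⟨h.toWalk, by simp [hu, hv]⟩

theorem symm (h : ReachableIn G X u v) : ReachableIn G X v u :=
  let ⟨w, hw⟩ := h
  ⟨w.reverse, by simpa using hw⟩

theorem trans (h : ReachableIn G X u v) (h' : ReachableIn G X v x) : ReachableIn G X u x := by
  obtain ⟨w, hw⟩ := h
  obtain ⟨w', hw'⟩ := h'
  exact ⟨w.append w', fun z hz => ((Walk.mem_support_append_iff _ _).1 hz).elim (hw z) (hw' z)⟩

theorem mono (h : ReachableIn G X u v) (hXY : X ⊆ Y) : ReachableIn G Y u v :=
  let ⟨w, hw⟩ := h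
  ⟨w, fun z hz => hXY (hw z hz)⟩

theorem exists_pathBetween (h : ReachableIn G X u v) (hu : u ∈ S) (hv : v ∈ T) :
    ∃ A : PathBetween G S T, A.verts ⊆ X := by
  classical
  obtain ⟨w, hw⟩ := h
  exact ⟨⟨u, v, hu, hv, w.toPath⟩, fun z hz => hw z (Walk.support_toPath_subset_support w hz)⟩

theorem exists_adj_boundary (h : ReachableIn G X u v) (hu : u ∈ Y) (hv : v ∉ Y) :
    ∃ a ∈ X, ∃ b ∈ X, G.Adj a b ∧ a ∈ Y ∧ b ∉ Y := by
  obtain ⟨w, hw⟩ := h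
  obtain ⟨d, hd, ha, hb⟩ := w.exists_boundary_dart Y hu hv
  exact ⟨d.fst, hw _ (w.dart_fst_mem_support_of_mem_darts hd), d.snd,
    hw _ (w.dart_snd_mem_support_of_mem_darts hd), d.adj, ha, hb⟩

end ReachableIn

theorem Within.reachableIn (h : Within G r u v) :
    ReachableIn G {z | ∃ k l, k + l ≤ r ∧ Within G k u z ∧ Within G l z v} u v := by
  classical
  obtain ⟨w, hw⟩ := h.exists_walk
  refine ⟨w, fun z hz => ⟨_, _, ?_, .of_walk (w.takeUntil z hz), .of_walk (w.dropUntil z hz)⟩⟩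
  rwa [← Walk.length_append, Walk.take_spec]

/-- A shortest path `p 0, …, p n` between `S` and `T`. The positions are integers, so that they can
be subtracted freely; values of `p` outside `0, …, n` are irrelevant. -/
structure Spine (G : SimpleGraph V) (S T : Set V) where
  /-- the vertices of the path -/
  p : ℤ → V
  /-- the length of the path -/
  n : ℤ
  n_nonneg : 0 ≤ n
  mem_S : p 0 ∈ S
  mem_T : p n ∈ T
  adj : ∀ i ∈ Set.Ico 0 n, G.Adj (p i) (p (i + 1))
  le_of_mem_S : ∀ s ∈ S, ∀ i ∈ Set.Icc 0 n, ∀ k : ℕ, Within G k s (p i) → i ≤ k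
  le_of_mem_T : ∀ t ∈ T, ∀ i ∈ Set.Icc 0 n, ∀ k : ℕ, Within G k t (p i) → n - i ≤ k

theorem exists_spine (A : PathBetween G S T) : Nonempty (Spine G S T) := by
  classical
  have hex : ∃ n : ℕ, ∃ s ∈ S, ∃ t ∈ T, ∃ w : G.Walk s t, w.length = n :=
    ⟨_, A.source, A.source_mem, A.target, A.target_mem, A.path, rfl⟩
  obtain ⟨s, hs, t, ht, w, hw⟩ := Nat.find_spec hex
  have hmin : ∀ s' ∈ S, ∀ t' ∈ T, ∀ k : ℕ, Within G k s' t' → w.length ≤ k := by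
    intro s' hs' t' ht' k hk
    obtain ⟨w', hw'⟩ := hk.exists_walk
    rw [hw]
    exact (Nat.find_min' hex ⟨s', hs', t', ht', w', rfl⟩).trans hw'
  have hprefix : ∀ j, Within G j s (w.getVert j) := fun j =>
    (Within.of_walk (w.take j)).mono (by simp)
  have hsuffix : ∀ j, Within G (w.length - j) (w.getVert j) t := fun j =>
    (Within.of_walk (w.drop j)).mono (by simp)
  refine ⟨⟨fun i => w.getVert i.toNat, w.length, by simp, by simpa using hs, by simpa using ht,
    ?_, ?_, ?_⟩⟩
  · rintro i ⟨hi, hin⟩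
    simp only [show (i + 1).toNat = i.toNat + 1 by omega]
    exact w.adj_getVert_succ (by omega)
  · rintro s' hs' i ⟨hi, hin⟩ k hk
    have := hmin s' hs' t ht _ (hk.trans (hsuffix i.toNat))
    omega
  · rintro t' ht' i ⟨hi, -⟩ k hk
    have := hmin s hs t' ht' _ ((hprefix i.toNat).trans hk.symm)
    omega

namespace Spine

variable {P : Spine G S T} {i j : ℤ}

theorem zero_mem_Icc : (0 : ℤ) ∈ Set.Icc 0 P.n := ⟨le_rfl, P.n_nonneg⟩

theorem n_mem_Icc : P.n ∈ Set.Icc 0 P.n := ⟨P.n_nonneg, le_rfl⟩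

theorem within_of_le (hi : 0 ≤ i) (hij : i ≤ j) (hj : j ≤ P.n) :
    Within G (j - i).toNat (P.p i) (P.p j) := by
  induction j, hij using Int.leInduction with
  | base => exact .refl _ _
  | succ j hij ih =>
    exact ((ih (by omega)).trans (.of_adj (P.adj j ⟨by omega, by omega⟩))).mono (by omega)

theorem within_natAbs (hi : i ∈ Set.Icc 0 P.n) (hj : j ∈ Set.Icc 0 P.n) :
    Within G (j - i).natAbs (P.p i) (P.p j) := by
  rcases le_total i j with h | h
  · exact (within_of_le hi.1 h hj.2).mono (by omega)
  · exact (within_of_le hj.1 h hi.2).symm.mono (by omega)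

theorem le_add_of_within (hi : i ∈ Set.Icc 0 P.n) (hj : j ∈ Set.Icc 0 P.n)
    (h : Within G k (P.p i) (P.p j)) : j ≤ i + k := by
  have := P.le_of_mem_S _ P.mem_S j hj _ ((within_of_le le_rfl hi.1 hi.2).trans h)
  have := hi.1
  omega

theorem reachableIn_of_le (hi : 0 ≤ i) (hij : i ≤ j) (hj : j ≤ P.n)
    (hX : ∀ l ∈ Set.Icc i j, P.p l ∈ X) : ReachableIn G X (P.p i) (P.p j) := by
  induction j, hij using Int.leInduction with
  | base => exact .refl (hX i ⟨le_rfl, le_rfl⟩)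
  | succ j hij ih =>
    exact (ih (by omega) fun l hl => hX l ⟨hl.1, by have := hl.2; omega⟩).trans
      (.of_adj (P.adj j ⟨by omega, by omega⟩) (hX j ⟨hij, by omega⟩)
        (hX (j + 1) ⟨by omega, le_rfl⟩))

theorem reachableIn_uIcc (hi : i ∈ Set.Icc 0 P.n) (hj : j ∈ Set.Icc 0 P.n)
    (hX : ∀ l ∈ Set.uIcc i j, P.p l ∈ X) : ReachableIn G X (P.p i) (P.p j) := by
  rcases le_total i j with h | h
  · rw [Set.uIcc_of_le h] at hX
    exact reachableIn_of_le hi.1 h hj.2 hX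
  · rw [Set.uIcc_of_ge h] at hX
    exact (reachableIn_of_le hj.1 h hi.2 hX).symm

/-- The vertices at distance more than `4r` from the spine. -/
def farSet (P : Spine G S T) (r : ℕ) : Set V :=
  {v | ∀ i ∈ Set.Icc 0 P.n, ¬ Within G (4 * r) v (P.p i)}

theorem exists_within_of_notMem_farSet (h : v ∉ P.farSet r) :
    ∃ i ∈ Set.Icc 0 P.n, Within G (4 * r) v (P.p i) := by
  simpa only [farSet, Set.mem_ofPred_eq, not_forall, not_not, exists_prop] using h

/-- A connected component of the part of `G` far from the spine. -/
abbrev FarComp (P : Spine G S T) (r : ℕ) := (G.induce (P.farSet r)).ConnectedComponent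

namespace FarComp

variable {A B C : FarComp P r}

/-- The vertices of a component, as vertices of `G`. -/
def verts (C : FarComp P r) : Set V := Subtype.val '' C.supp

theorem mem_farSet (h : v ∈ C.verts) : v ∈ P.farSet r := by
  obtain ⟨v', -, rfl⟩ := h
  exact v'.2

theorem exists_mem_verts (h : v ∈ P.farSet r) : ∃ C : FarComp P r, v ∈ C.verts :=
  ⟨(G.induce (P.farSet r)).connectedComponentMk ⟨v, h⟩, ⟨v, h⟩, rfl, rfl⟩

theorem eq_of_mem_verts (hA : v ∈ A.verts) (hB : v ∈ B.verts) : A = B := by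
  obtain ⟨v₁, hA, rfl⟩ := hA
  obtain ⟨v₂, hB, h⟩ := hB
  exact ConnectedComponent.eq_of_common_vertex hA (Subtype.ext h ▸ hB)

theorem mem_verts_of_adj (hu : u ∈ C.verts) (h : G.Adj u v) (hv : v ∈ P.farSet r) :
    v ∈ C.verts := by
  obtain ⟨u', hu', rfl⟩ := hu
  exact ⟨⟨v, hv⟩, C.mem_supp_of_adj_mem_supp hu' h, rfl⟩

theorem reachableIn_verts (hu : u ∈ C.verts) (hv : v ∈ C.verts) :
    ReachableIn G C.verts u v := by
  classical
  obtain ⟨u', hu', rfl⟩ := hu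
  obtain ⟨v', hv', rfl⟩ := hv
  obtain ⟨w⟩ := C.reachable_of_mem_supp hu' hv'
  let ι := (Embedding.induce (G := G) (P.farSet r)).toHom
  change ReachableIn G C.verts (ι u') (ι v')
  refine ⟨w.map ι, fun z hz => ?_⟩
  rw [Walk.support_map, List.mem_map] at hz
  obtain ⟨z', hz', rfl⟩ := hz
  exact ⟨z', (ConnectedComponent.sound (w.takeUntil z' hz').reachable).symm.trans hu', rfl⟩

/-- The positions at which a component attaches to the spine, where `-(39r + 9)` stands for `S` and
`n + (39r + 9)` for `T`; they are so far out that a component can bypass either end of the spine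
only by meeting `S` or `T`. -/
def att (C : FarComp P r) : Set ℤ :=
  {x | (x ∈ Set.Icc 0 P.n ∧ Close G (4 * r + 1) (P.p x) C.verts) ∨
    (x = -(39 * r + 9) ∧ (C.verts ∩ S).Nonempty) ∨
    (x = P.n + (39 * r + 9) ∧ (C.verts ∩ T).Nonempty)}

/-- The component `A` attaches to the spine at least `k` positions later than `B` does: walking
forwards through `A` and backwards through `B` leads past the stretch in between. -/
def Overlap (k : ℕ) (A B : FarComp P r) : Prop := ∃ x ∈ A.att, ∃ y ∈ B.att, y + k ≤ x

/-- The component `A` overlaps `B` or is close to it. -/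
def Link (A B : FarComp P r) : Prop := Overlap (9 * r + 3) A B ∨ Near G (2 * r) A.verts B.verts

theorem Overlap.mono (h : Overlap l A B) (hkl : k ≤ l) : Overlap k A B :=
  let ⟨x, hx, y, hy, hxy⟩ := h
  ⟨x, hx, y, hy, by omega⟩

theorem mem_att_of_adj {x : ℤ} (hu : u ∈ C.verts) (h : G.Adj u v) (hx : x ∈ Set.Icc 0 P.n)
    (hv : Within G (4 * r) v (P.p x)) : x ∈ C.att :=
  .inl ⟨hx, u, hu, hv.symm.trans (Within.of_adj h).symm⟩

theorem exists_exit (hu : u ∈ C.verts) (hv : v ∉ C.verts) (h : Within G k u v) :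
    ∃ b ∉ P.farSet r, Within G k b v ∧
      ∃ x ∈ C.att, x ∈ Set.Icc 0 P.n ∧ Within G (4 * r) b (P.p x) := by
  obtain ⟨a, -, b, ⟨_, l, hl, -, hbv⟩, hab, ha, hb⟩ :=
    h.reachableIn.exists_adj_boundary hu hv
  have hfar : b ∉ P.farSet r := fun hfar => hb (mem_verts_of_adj ha hab hfar)
  obtain ⟨x, hx, hbx⟩ := exists_within_of_notMem_farSet hfar
  exact ⟨b, hfar, hbv.mono (by omega), x, mem_att_of_adj ha hab hx hbx, hx, hbx⟩

theorem exists_att_of_near (h : Near G k A.verts B.verts) (hne : A ≠ B) :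
    ∃ x ∈ A.att, ∃ y ∈ B.att, y ≤ x + (k + 8 * r : ℕ) := by
  obtain ⟨u, hu, v, hv, huv⟩ := h
  obtain ⟨b, hb, hbv, x, hxA, hx, hbx⟩ :=
    exists_exit hu (fun hvA => hne (eq_of_mem_verts hvA hv)) huv
  obtain ⟨b', -, hbb', y, hyB, hy, hby⟩ :=
    exists_exit hv (fun hbB => hb (mem_farSet hbB)) hbv.symm
  refine ⟨x, hxA, y, hyB, le_add_of_within hx hy ?_⟩
  exact ((hbx.symm.trans hbb'.symm).trans hby).mono (by omega)

/-- The component `C` attaches both well before and well after the position `i`. -/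
def Bypasses (C : FarComp P r) (i : ℤ) : Prop :=
  (∃ x ∈ C.att, x + (39 * r + 9) ≤ i) ∧ ∃ y ∈ C.att, i + (39 * r + 9) ≤ y

end FarComp

/-- Every position of the spine is bypassed by some component. -/
def Bypassed (P : Spine G S T) (r : ℕ) : Prop :=
  ∀ i ∈ Set.Icc 0 P.n, ∃ C : FarComp P r, C.Bypasses i

/-- The vertex `u` is on the side of `S` relative to the position `i`: it is close to the spine
at or before `i`, or in a component that attaches well before `i`. -/
def Before (P : Spine G S T) (r : ℕ) (i : ℤ) (u : V) : Prop :=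
  (∃ j ∈ Set.Icc 0 i, Within G (4 * r) u (P.p j)) ∨
    ∃ C : FarComp P r, u ∈ C.verts ∧ ∃ x ∈ C.att, x + (39 * r + 9) ≤ i

theorem add_le_or_add_le_of_not_within (hi : i ∈ Set.Icc 0 P.n) (hj : j ∈ Set.Icc 0 P.n)
    (h : ¬ Within G (43 * r + 8) u (P.p i)) (hu : Within G (4 * r) u (P.p j)) :
    j + (39 * r + 9) ≤ i ∨ i + (39 * r + 9) ≤ j := by
  by_contra hlt
  exact h ((hu.trans (within_natAbs hj hi)).mono (by omega))

theorem before_of_mem_S (hi : i ∈ Set.Icc 0 P.n) (hu : u ∈ S)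
    (h : ¬ Within G (43 * r + 8) u (P.p i)) : P.Before r i u := by
  have hi0 := hi.1
  by_cases hfar : u ∈ P.farSet r
  · obtain ⟨C, hC⟩ := FarComp.exists_mem_verts hfar
    exact .inr ⟨C, hC, _, .inr (.inl ⟨rfl, u, hC, hu⟩), by omega⟩
  · obtain ⟨j, hj, huj⟩ := exists_within_of_notMem_farSet hfar
    have := P.le_of_mem_S u hu j hj _ huj
    exact .inl ⟨j, ⟨hj.1, by have := add_le_or_add_le_of_not_within hi hj h huj; omega⟩, huj⟩

theorem not_before_of_mem_T (hi : i ∈ Set.Icc 0 P.n) (hu : u ∈ T)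
    (h : ¬ Within G (43 * r + 8) u (P.p i)) (hno : ∀ C : FarComp P r, ¬ C.Bypasses i) :
    ¬ P.Before r i u := by
  have hin := hi.2
  rintro (⟨j, ⟨hj0, hji⟩, huj⟩ | ⟨C, hC, hx⟩)
  · have hj : j ∈ Set.Icc 0 P.n := ⟨hj0, hji.trans hin⟩
    have := P.le_of_mem_T u hu j hj _ huj
    have := add_le_or_add_le_of_not_within hi hj h huj
    omega
  · exact hno C ⟨hx, _, .inr (.inr ⟨rfl, u, hC, hu⟩), by omega⟩

theorem Before.of_adj (hi : i ∈ Set.Icc 0 P.n) (hno : ∀ C : FarComp P r, ¬ C.Bypasses i)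
    (huv : G.Adj u v) (hu : ¬ Within G (43 * r + 8) u (P.p i))
    (hv : ¬ Within G (43 * r + 8) v (P.p i)) (h : P.Before r i u) : P.Before r i v := by
  have hin := hi.2
  by_cases hfar : v ∈ P.farSet r
  · right
    rcases h with ⟨j, ⟨hj0, hji⟩, huj⟩ | ⟨C, hC, hx⟩
    · have hj : j ∈ Set.Icc 0 P.n := ⟨hj0, hji.trans hin⟩
      obtain ⟨C, hC⟩ := FarComp.exists_mem_verts hfar
      have := add_le_or_add_le_of_not_within hi hj hu huj
      exact ⟨C, hC, j, FarComp.mem_att_of_adj hC huv.symm hj huj, by omega⟩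
    · exact ⟨C, FarComp.mem_verts_of_adj hC huv hfar, hx⟩
  · left
    obtain ⟨j', hj', hvj⟩ := exists_within_of_notMem_farSet hfar
    rcases add_le_or_add_le_of_not_within hi hj' hv hvj with hle | hge
    · exact ⟨j', ⟨hj'.1, by omega⟩, hvj⟩
    rcases h with ⟨j, ⟨hj0, hji⟩, huj⟩ | ⟨C, hC, hx⟩
    · have := le_add_of_within ⟨hj0, hji.trans hin⟩ hj'
        ((huj.symm.trans (.of_adj huv)).trans hvj)
      omega
    · exact absurd ⟨hx, j', FarComp.mem_att_of_adj hC huv hj' hvj, hge⟩ (hno C)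

theorem exists_bypasses (hi : i ∈ Set.Icc 0 P.n) (A : PathBetween G S T)
    (hA : ∀ z ∈ A.verts, ¬ Within G (43 * r + 8) z (P.p i)) : ∃ C : FarComp P r, C.Bypasses i := by
  by_contra! hno
  have hpath : ReachableIn G A.verts A.source A.target := ⟨A.path, fun _ hz => hz⟩
  obtain ⟨a, ha, b, hb, hab, ha', hb'⟩ := hpath.exists_adj_boundary (Y := {z | P.Before r i z})
    (before_of_mem_S hi A.source_mem (hA _ (Walk.start_mem_support _)))
    (not_before_of_mem_T hi A.target_mem (hA _ (Walk.end_mem_support _)) hno)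
  exact hb' (.of_adj hi hno hab (hA a ha) (hA b hb) ha')

namespace FarComp

variable {A B C : FarComp P r}

/-- One step of a chain of components and its cost. The costs are such that two `deep` steps are
cheaper than a `deep` step and a `link`, while three steps always cost more than two `deep` ones. -/
inductive Step : FarComp P r → FarComp P r → ℕ → Prop
  | deep {A B : FarComp P r} : Overlap (18 * r + 6) A B → Step A B 2
  | link {A B : FarComp P r} : Link A B → Step A B 3

theorem Step.two_le (h : Step A B k) : 2 ≤ k := by cases h <;> omega

theorem Step.to_link (h : Step A B k) : Link A B := by
  cases h with
  | deep h => exact .inl (h.mono (by omega))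
  | link h => exact h

/-- A chain of components, together with its total cost. -/
inductive Chain : FarComp P r → FarComp P r → ℕ → Prop
  | nil (A : FarComp P r) : Chain A A 0
  | cons {A B C : FarComp P r} {k l : ℕ} : Step A B k → Chain B C l → Chain A C (k + l)

theorem Step.chain (h : Step A B k) : Chain A B k := .cons h (.nil B)

theorem Chain.trans (h : Chain A B k) (h' : Chain B C l) : Chain A C (k + l) := by
  induction h with
  | nil => rwa [zero_add]
  | cons hs _ ih => rw [add_assoc]; exact .cons hs (ih h')

theorem Chain.exists_seq (h : Chain A B k) :
    ∃ (m : ℕ) (c : ℕ → FarComp P r) (κ : ℕ → ℕ), c 0 = A ∧ c m = B ∧ κ 0 = 0 ∧ κ m = k ∧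
      ∀ t < m, ∃ a, Step (c t) (c (t + 1)) a ∧ κ (t + 1) = κ t + a := by
  induction h with
  | nil A => exact ⟨0, fun _ => A, fun _ => 0, rfl, rfl, rfl, rfl, by simp⟩
  | @cons A B C a l hs _ ih =>
    obtain ⟨m, c, κ, rfl, rfl, hκ0, rfl, hstep⟩ := ih
    refine ⟨m + 1, fun | 0 => A | t + 1 => c t, fun | 0 => 0 | t + 1 => a + κ t,
      rfl, rfl, rfl, rfl, ?_⟩
    rintro (_ | t) ht
    · exact ⟨a, hs, by simp [hκ0]⟩
    · obtain ⟨a', hs', hκ⟩ := hstep t (by omega)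
      exact ⟨a', hs', by simp only [hκ, add_assoc]⟩

theorem meets_S_of_bypasses (h : C.Bypasses 0) : (C.verts ∩ S).Nonempty := by
  have hn := P.n_nonneg
  obtain ⟨⟨x, hx | ⟨-, hS⟩ | ⟨hx, -⟩, hx0⟩, -⟩ := h
  · have := hx.1.1
    omega
  · exact hS
  · omega

theorem meets_T_of_bypasses (h : C.Bypasses P.n) : (C.verts ∩ T).Nonempty := by
  have hn := P.n_nonneg
  obtain ⟨-, y, hy | ⟨hy, -⟩ | ⟨-, hT⟩, hyn⟩ := h
  · have := hy.1.2
    omega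
  · omega
  · exact hT

theorem Bypasses.step (hA : A.Bypasses i) (hB : B.Bypasses (i + 1)) : Step A B 2 := by
  obtain ⟨-, x, hx, hix⟩ := hA
  obtain ⟨⟨y, hy, hyi⟩, -⟩ := hB
  exact .deep ⟨x, hx, y, hy, by omega⟩

end FarComp

theorem Bypassed.exists_chain (hP : P.Bypassed r) :
    ∃ (k : ℕ) (A B : FarComp P r), (A.verts ∩ S).Nonempty ∧ (B.verts ∩ T).Nonempty ∧
      FarComp.Chain A B k := by
  obtain ⟨A, hA⟩ := hP 0 ⟨le_rfl, P.n_nonneg⟩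
  have key : ∀ i : ℤ, 0 ≤ i → i ≤ P.n →
      ∃ B : FarComp P r, B.Bypasses i ∧ ∃ k, FarComp.Chain A B k := by
    intro i hi
    induction i, hi using Int.leInduction with
    | base => exact fun _ => ⟨A, hA, 0, .nil A⟩
    | succ i hi ih =>
      intro hin
      obtain ⟨B, hB, k, hAB⟩ := ih (by omega)
      obtain ⟨C, hC⟩ := hP (i + 1) ⟨by omega, hin⟩
      exact ⟨C, hC, _, hAB.trans (hB.step hC).chain⟩
  obtain ⟨B, hB, k, hAB⟩ := key P.n P.n_nonneg le_rfl
  exact ⟨k, A, B, FarComp.meets_S_of_bypasses hA, FarComp.meets_T_of_bypasses hB, hAB⟩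

/-- A cheapest chain of components from `S` to `T`. -/
structure MinChain (P : Spine G S T) (r : ℕ) where
  /-- the number of steps -/
  m : ℕ
  /-- the components -/
  c : ℕ → FarComp P r
  /-- the partial costs: `κ t` is the cost of the first `t` steps -/
  κ : ℕ → ℕ
  meets_S : ((c 0).verts ∩ S).Nonempty
  meets_T : ((c m).verts ∩ T).Nonempty
  κ_zero : κ 0 = 0
  step : ∀ t < m, ∃ a, FarComp.Step (c t) (c (t + 1)) a ∧ κ (t + 1) = κ t + a
  minimal : ∀ (A B : FarComp P r) (k : ℕ), (A.verts ∩ S).Nonempty → (B.verts ∩ T).Nonempty →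
    FarComp.Chain A B k → κ m ≤ k

theorem Bypassed.exists_minChain (hP : P.Bypassed r) : Nonempty (MinChain P r) := by
  classical
  obtain ⟨A, B, hA, hB, hAB⟩ := Nat.find_spec hP.exists_chain
  obtain ⟨m, c, κ, rfl, rfl, hκ0, hκm, hstep⟩ := hAB.exists_seq
  refine ⟨⟨m, c, κ, hA, hB, hκ0, hstep, fun A' B' k hA' hB' hk => ?_⟩⟩
  rw [hκm]
  exact Nat.find_min' hP.exists_chain ⟨A', B', hA', hB', hk⟩

namespace MinChain

open FarComp (Overlap Link Step Chain)

variable {Q : MinChain P r} {s t q : ℕ}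

theorem link (ht : t < Q.m) : Link (Q.c t) (Q.c (t + 1)) :=
  let ⟨_, hs, _⟩ := Q.step t ht
  hs.to_link

theorem exists_chain (hst : s ≤ t) (ht : t ≤ Q.m) :
    ∃ k, Chain (Q.c s) (Q.c t) k ∧ Q.κ t = Q.κ s + k := by
  induction t, hst using Nat.le_induction with
  | base => exact ⟨0, .nil _, rfl⟩
  | succ t _ ih =>
    obtain ⟨k, hk, hκ⟩ := ih (by omega)
    obtain ⟨a, ha, hκ'⟩ := Q.step t ht
    exact ⟨k + a, hk.trans ha.chain, by omega⟩

theorem add_le_κ (hst : s ≤ t) (ht : t ≤ Q.m) : Q.κ s + 2 * (t - s) ≤ Q.κ t := by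
  induction t, hst using Nat.le_induction with
  | base => simp
  | succ t hst ih =>
    obtain ⟨a, ha, hκ⟩ := Q.step t ht
    have := ih (by omega)
    have := ha.two_le
    omega

theorem κ_le_add (hs : s ≤ Q.m) (ht : t ≤ Q.m) (h : Chain (Q.c s) (Q.c t) k) :
    Q.κ t ≤ Q.κ s + k := by
  obtain ⟨k₁, h₁, hκ₁⟩ := Q.exists_chain (Nat.zero_le s) hs
  obtain ⟨k₂, h₂, hκ₂⟩ := Q.exists_chain ht le_rfl
  have := Q.minimal _ _ _ Q.meets_S Q.meets_T ((h₁.trans h).trans h₂)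
  have := Q.κ_zero
  omega

theorem not_link (hst : s + 2 ≤ t) (ht : t ≤ Q.m) : ¬ Link (Q.c s) (Q.c t) := by
  intro h
  have := κ_le_add (by omega) ht (Step.link h).chain
  have := Q.add_le_κ (s := s) (by omega) ht
  omega

theorem eq_zero_of_meets (ht : t ≤ Q.m) (h : ((Q.c t).verts ∩ S).Nonempty) : t = 0 := by
  obtain ⟨k, hk, hκ⟩ := Q.exists_chain ht le_rfl
  have := Q.minimal _ _ _ h Q.meets_T hk
  have := Q.add_le_κ (Nat.zero_le t) ht
  have := Q.κ_zero
  omega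

theorem eq_m_of_meets (ht : t ≤ Q.m) (h : ((Q.c t).verts ∩ T).Nonempty) : t = Q.m := by
  obtain ⟨k, hk, hκ⟩ := Q.exists_chain (Nat.zero_le t) ht
  have := Q.minimal _ _ _ Q.meets_S h hk
  have := Q.add_le_κ ht le_rfl
  have := Q.κ_zero
  omega

theorem add_le_of_att (hP : P.Bypassed r) (hst : s + 3 ≤ t) (ht : t ≤ Q.m) {x y : ℤ}
    (hx : x ∈ (Q.c s).att) (hy : y ∈ (Q.c t).att) : x + (21 * r + 3) ≤ y := by
  by_contra hlt
  have hn := P.n_nonneg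
  rcases id hx with ⟨hx0, -⟩ | ⟨hx0, -⟩ | ⟨-, hT⟩
  · obtain ⟨C, ⟨x', hx', hxx'⟩, y', hy', hyy'⟩ := hP x hx0
    have hsC : Step (Q.c s) C 2 := .deep ⟨x, hx, x', hx', by omega⟩
    have hCt : Step C (Q.c t) 2 := .deep ⟨y', hy', y, hy, by omega⟩
    have := κ_le_add (by omega) ht (hsC.chain.trans hCt.chain)
    have := Q.add_le_κ (s := s) (by omega) ht
    omega
  · rcases hy with ⟨⟨hy0, -⟩, -⟩ | ⟨-, hS⟩ | ⟨hy0, -⟩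
    · omega
    · have := Q.eq_zero_of_meets ht hS
      omega
    · omega
  · have := Q.eq_m_of_meets (by omega) hT
    omega

theorem not_near (hP : P.Bypassed r) (hst : s + 3 ≤ t) (ht : t ≤ Q.m) (hk : k ≤ 13 * r + 2) :
    ¬ Near G k (Q.c s).verts (Q.c t).verts := by
  intro h
  have hne : Q.c s ≠ Q.c t := by
    intro heq
    have hnil : Chain (Q.c s) (Q.c t) 0 := heq ▸ .nil _
    have := κ_le_add (by omega) ht hnil
    have := Q.add_le_κ (s := s) (by omega) ht
    omega
  obtain ⟨x, hx, y, hy, hxy⟩ := FarComp.exists_att_of_near h hne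
  have := add_le_of_att hP hst ht hx hy
  omega

theorem deep_of_deep (ht : t + 2 ≤ Q.m) {C : FarComp P r} (h : Overlap (18 * r + 6) (Q.c t) C)
    (h' : Overlap (18 * r + 6) C (Q.c (t + 2))) :
    Overlap (18 * r + 6) (Q.c t) (Q.c (t + 1)) ∧
      Overlap (18 * r + 6) (Q.c (t + 1)) (Q.c (t + 2)) := by
  have := κ_le_add (by omega) ht ((Step.deep h).chain.trans (Step.deep h').chain)
  obtain ⟨a, ha, hκ⟩ := Q.step t (by omega)
  obtain ⟨a', ha', hκ'⟩ := Q.step (t + 1) (by omega)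
  simp only [add_assoc, Nat.reduceAdd] at ha' hκ'
  have := ha.two_le
  have := ha'.two_le
  obtain ⟨rfl, rfl⟩ : a = 2 ∧ a' = 2 := by omega
  cases ha with | deep hd₁ => cases ha' with | deep hd₂ => exact ⟨hd₁, hd₂⟩

/-- The vertex `z` is close to the components of index `q`, `q + 1` and `q + 2`. -/
def IsCentre (Q : MinChain P r) (q : ℕ) (z : V) : Prop :=
  q + 2 ≤ Q.m ∧ ∀ t ∈ Set.Icc q (q + 2), Close G (3 * r) z (Q.c t).verts

/-- The components of index `t` and `t + 1` can be joined away from the spine, so that the two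
paths do not swap sides between them. -/
def Merges (Q : MinChain P r) (t : ℕ) : Prop :=
  Near G (2 * r) (Q.c t).verts (Q.c (t + 1)).verts ∨
    ∃ q z, q ≤ t ∧ t ≤ q + 1 ∧ Q.IsCentre q z

open Classical in
/-- The side, that is, which of the two paths runs through the component of index `t`. -/
noncomputable def side (Q : MinChain P r) : ℕ → Bool
  | 0 => true
  | t + 1 => if Q.Merges t then Q.side t else !Q.side t

theorem side_succ_of_merges (h : Q.Merges t) : Q.side (t + 1) = Q.side t := by
  simp [side, h]

theorem side_succ_of_not_merges (h : ¬ Q.Merges t) : Q.side (t + 1) = !Q.side t := by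
  simp [side, h]

theorem IsCentre.merges {z : V} (h : Q.IsCentre q z) (hqt : q ≤ t) (htq : t ≤ q + 1) :
    Q.Merges t :=
  .inr ⟨q, z, hqt, htq, h⟩

theorem IsCentre.side_eq {z : V} (h : Q.IsCentre q z) (ht : t ∈ Set.Icc q (q + 2)) :
    Q.side t = Q.side q := by
  have h₁ : Q.side (q + 1) = Q.side q := side_succ_of_merges (h.merges le_rfl (by omega))
  have h₂ : Q.side (q + 1 + 1) = Q.side (q + 1) :=
    side_succ_of_merges (h.merges (by omega) le_rfl)
  obtain rfl | rfl | rfl : t = q ∨ t = q + 1 ∨ t = q + 1 + 1 := by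
    obtain ⟨hqt, htq⟩ := ht
    omega
  exacts [rfl, h₁, h₂.trans h₁]

theorem not_near_of_side_ne (hs : s ≤ Q.m) (ht : t ≤ Q.m) (h : Q.side s ≠ Q.side t) :
    ¬ Near G (2 * r) (Q.c s).verts (Q.c t).verts := by
  intro hn
  wlog hst : s ≤ t generalizing s t
  · exact this ht hs h.symm hn.symm (by omega)
  obtain rfl | rfl | hst : s = t ∨ t = s + 1 ∨ s + 2 ≤ t := by omega
  · exact h rfl
  · exact h (side_succ_of_merges (.inl hn)).symm
  · exact not_link hst ht (.inr hn)

/-- At an index `t < m` that does not merge, the path on the side of `t` leaves the component `t`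
for the spine at the position `b t`, and the other path leaves the spine for the component `t + 1`
at the earlier position `a t`. -/
structure Turns (Q : MinChain P r) where
  /-- the exit positions -/
  b : ℕ → ℤ
  /-- the entry positions -/
  a : ℕ → ℤ
  a_m : a Q.m = P.n
  mem_b : ∀ t < Q.m, ¬ Q.Merges t → b t ∈ (Q.c t).att
  mem_a : ∀ t < Q.m, ¬ Q.Merges t → a t ∈ (Q.c (t + 1)).att
  add_le : ∀ t < Q.m, ¬ Q.Merges t → a t + (9 * r + 3) ≤ b t
  deep : ∀ t < Q.m, ¬ Q.Merges t →
    Overlap (18 * r + 6) (Q.c t) (Q.c (t + 1)) → a t + (18 * r + 6) ≤ b t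

theorem exists_turn (ht : t < Q.m) (h : ¬ Q.Merges t) :
    ∃ b ∈ (Q.c t).att, ∃ a ∈ (Q.c (t + 1)).att, a + (9 * r + 3) ≤ b ∧
      (Overlap (18 * r + 6) (Q.c t) (Q.c (t + 1)) → a + (18 * r + 6) ≤ b) := by
  by_cases hd : Overlap (18 * r + 6) (Q.c t) (Q.c (t + 1))
  · obtain ⟨b, hb, a, ha, hab⟩ := id hd
    exact ⟨b, hb, a, ha, by omega, fun _ => by omega⟩
  · rcases Q.link ht with ⟨b, hb, a, ha, hab⟩ | hn
    · exact ⟨b, hb, a, ha, by omega, fun h => absurd h hd⟩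
    · exact absurd (.inl hn) h

theorem exists_turns (Q : MinChain P r) : Nonempty Q.Turns := by
  classical
  choose b mem_b a mem_a add_le deep using fun t (h : t < Q.m ∧ ¬ Q.Merges t) =>
    exists_turn h.1 h.2
  refine ⟨⟨fun t => if h : _ then b t h else 0, fun t => if h : _ then a t h else P.n,
    dif_neg fun h => h.1.false, ?_, ?_, ?_, ?_⟩⟩
  all_goals
    intro t ht h
    simp only [dif_pos (⟨ht, h⟩ : t < Q.m ∧ ¬ Q.Merges t)]
  exacts [mem_b t _, mem_a t _, add_le t _, deep t _]

/-- At the index `t` the path that avoids the component `t` leaves the spine, either for the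
component `t + 1` or because it has reached `T`. -/
def IsTurn (Q : MinChain P r) (t : ℕ) : Prop := t ≤ Q.m ∧ (t < Q.m → ¬ Q.Merges t)

namespace Turns

variable {R : Q.Turns}

theorem b_mem_Icc (ht : t < Q.m) (h : ¬ Q.Merges t) : R.b t ∈ Set.Icc 0 P.n := by
  have hab := R.add_le t ht h
  have hn := P.n_nonneg
  rcases R.mem_b t ht h with ⟨hb, -⟩ | ⟨hb, -⟩ | ⟨-, hT⟩
  · exact hb
  · rcases R.mem_a t ht h with ⟨⟨ha, -⟩, -⟩ | ⟨ha, -⟩ | ⟨ha, -⟩ <;> omega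
  · have := Q.eq_m_of_meets ht.le hT
    omega

theorem a_mem_Icc (ht : t < Q.m) (h : ¬ Q.Merges t) : R.a t ∈ Set.Icc 0 P.n := by
  have hab := R.add_le t ht h
  have hb := (R.b_mem_Icc ht h).2
  rcases R.mem_a t ht h with ⟨ha, -⟩ | ⟨-, hS⟩ | ⟨ha, -⟩
  · exact ha
  · have := Q.eq_zero_of_meets ht hS
    omega
  · omega

theorem a_add_le_a (hP : P.Bypassed r) (hst : s < t) (ht : t < Q.m) (h : ¬ Q.Merges s)
    (h' : ¬ Q.Merges t) : R.a s + (9 * r + 3) ≤ R.a t := by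
  have hab := R.add_le s (by omega) h
  have hbs := R.mem_b s (by omega) h
  have hat := R.mem_a t ht h'
  obtain rfl | hst : t = s + 1 ∨ s + 2 ≤ t := by omega
  · by_contra hlt
    obtain ⟨C, ⟨x, hx, hxa⟩, y, hy, hay⟩ := hP _ (R.a_mem_Icc ht h')
    have hdeep := R.deep s (by omega) h (deep_of_deep ht (C := C) ⟨_, hbs, x, hx, by omega⟩
      ⟨y, hy, _, hat, by omega⟩).1
    exact not_link (s := s) le_rfl ht (.inl ⟨_, hbs, _, hat, by omega⟩)
  · have := add_le_of_att hP (by omega) ht hbs hat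
    omega

theorem b_add_le_b (hP : P.Bypassed r) (hst : s < t) (ht : t < Q.m) (h : ¬ Q.Merges s)
    (h' : ¬ Q.Merges t) : R.b s + (9 * r + 3) ≤ R.b t := by
  have hab := R.add_le t ht h'
  have hbs := R.mem_b s (by omega) h
  have hat := R.mem_a t ht h'
  obtain rfl | hst : t = s + 1 ∨ s + 2 ≤ t := by omega
  · by_contra hlt
    obtain ⟨C, ⟨x, hx, hxb⟩, y, hy, hby⟩ := hP _ (R.b_mem_Icc (by omega) h)
    have hdeep := R.deep _ ht h' (deep_of_deep ht (C := C) ⟨_, hbs, x, hx, by omega⟩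
      ⟨y, hy, _, hat, by omega⟩).2
    exact not_link (s := s) le_rfl ht (.inl ⟨_, hbs, _, hat, by omega⟩)
  · have := add_le_of_att hP (by omega) ht hbs hat
    omega

open Classical in
/-- The position from which the path that avoids the component `t` continues along the spine. -/
noncomputable def head (R : Q.Turns) : ℕ → ℤ
  | 0 => 0
  | t + 1 => if Q.Merges t then R.head t else R.b t

theorem head_succ_of_merges (h : Q.Merges t) : R.head (t + 1) = R.head t := by
  simp [head, h]

theorem head_succ_of_not_merges (h : ¬ Q.Merges t) : R.head (t + 1) = R.b t := by
  simp [head, h]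

theorem head_cases (R : Q.Turns) (t : ℕ) :
    R.head t = 0 ∨ ∃ s < t, ¬ Q.Merges s ∧ R.head t = R.b s := by
  induction t with
  | zero => exact .inl rfl
  | succ t ih =>
    by_cases h : Q.Merges t
    · rw [head_succ_of_merges h]
      exact ih.imp_right fun ⟨s, hst, hs⟩ => ⟨s, by omega, hs⟩
    · exact .inr ⟨t, by omega, h, head_succ_of_not_merges h⟩

theorem head_mem_Icc (ht : t ≤ Q.m) : R.head t ∈ Set.Icc 0 P.n := by
  obtain h | ⟨s, hst, hs, h⟩ := R.head_cases t
  · exact h ▸ P.zero_mem_Icc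
  · exact h ▸ R.b_mem_Icc (by omega) hs

theorem b_le_head (hP : P.Bypassed r) (hst : s < t) (ht : t ≤ Q.m) (h : ¬ Q.Merges s) :
    R.b s ≤ R.head t := by
  induction t with
  | zero => omega
  | succ t ih =>
    by_cases h' : Q.Merges t
    · have hst : s < t := (Nat.lt_succ_iff.1 hst).lt_of_ne fun hst => h (hst ▸ h')
      exact (ih hst (by omega)).trans (head_succ_of_merges h').ge
    · rw [head_succ_of_not_merges h']
      obtain rfl | hst := (Nat.lt_succ_iff.1 hst).eq_or_lt
      · exact le_rfl
      · have := R.b_add_le_b hP hst ht h h'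
        omega

theorem head_add_le_b (hP : P.Bypassed r) (ht : t < Q.m) (h : ¬ Q.Merges t) :
    R.head t + (9 * r + 3) ≤ R.b t := by
  obtain h₀ | ⟨s, hst, hs, h₀⟩ := R.head_cases t <;> rw [h₀]
  · have := R.add_le t ht h
    have := (R.a_mem_Icc ht h).1
    omega
  · exact R.b_add_le_b hP hst ht hs h

theorem head_add_le_a (hP : P.Bypassed r) (hst : s < t) (ht : t < Q.m) (h : ¬ Q.Merges s)
    (h' : ¬ Q.Merges t) : R.head s + (9 * r + 3) ≤ R.a t := by
  obtain h₀ | ⟨j, hjs, hj, h₀⟩ := R.head_cases s <;> rw [h₀]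
  · have := R.a_add_le_a hP hst ht h h'
    have := (R.a_mem_Icc (hst.trans ht) h).1
    omega
  · have := add_le_of_att hP (by omega) ht (R.mem_b j (by omega) hj) (R.mem_a t ht h')
    omega

theorem a_mem_Icc_of_isTurn (h : Q.IsTurn t) : R.a t ∈ Set.Icc 0 P.n := by
  obtain ht | rfl := h.1.lt_or_eq
  · exact R.a_mem_Icc ht (h.2 ht)
  · exact R.a_m.symm ▸ P.n_mem_Icc

theorem mem_Icc_of_mem_uIcc (h : Q.IsTurn t) (hi : i ∈ Set.uIcc (R.head t) (R.a t)) :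
    i ∈ Set.Icc 0 P.n :=
  Set.uIcc_subset_Icc (R.head_mem_Icc h.1) (a_mem_Icc_of_isTurn h) hi

theorem exists_isTurn (R : Q.Turns) (ht : t ≤ Q.m) :
    ∃ s, Q.IsTurn s ∧ R.head s = R.head t ∧ Q.side s = Q.side t := by
  induction ht using Nat.decreasingInduction with
  | self => exact ⟨Q.m, ⟨le_rfl, fun h => absurd h (lt_irrefl _)⟩, rfl, rfl⟩
  | of_succ t ht ih =>
    by_cases h : Q.Merges t
    · rwa [head_succ_of_merges h, side_succ_of_merges h] at ih
    · exact ⟨t, ⟨ht.le, fun _ => h⟩, rfl, rfl⟩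

theorem add_le_of_mem_uIcc (hP : P.Bypassed r) (hst : s < t) (hs : Q.IsTurn s) (ht : Q.IsTurn t)
    (hi : i ∈ Set.uIcc (R.head s) (R.a s)) (hj : j ∈ Set.uIcc (R.head t) (R.a t)) :
    i + (9 * r + 3) ≤ j := by
  have hsm : s < Q.m := hst.trans_le ht.1
  have hmerge := hs.2 hsm
  have hab := R.add_le s hsm hmerge
  have hhb := R.head_add_le_b hP hsm hmerge
  have hbh := R.b_le_head hP hst ht.1 hmerge
  have ha : R.a s + (9 * r + 3) ≤ R.a t ∧ R.head s + (9 * r + 3) ≤ R.a t := by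
    obtain htm | rfl := ht.1.lt_or_eq
    · have ht' := ht.2 htm
      exact ⟨R.a_add_le_a hP hst htm hmerge ht', R.head_add_le_a hP hst htm hmerge ht'⟩
    · rw [R.a_m]
      have := (R.b_mem_Icc hsm hmerge).2
      omega
  rw [Set.mem_uIcc] at hi hj
  omega

end Turns

theorem not_within_of_close_verts {C : FarComp P r} (hu : Close G k u C.verts)
    (hi : i ∈ Set.Icc 0 P.n) (hkl : k + l ≤ 4 * r) : ¬ Within G l u (P.p i) := by
  obtain ⟨y, hy, huy⟩ := hu
  exact fun h => FarComp.mem_farSet hy i hi ((huy.symm.trans h).mono hkl)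

theorem index_le_of_close (hP : P.Bypassed r) (hs : s ≤ Q.m) (ht : t ≤ Q.m)
    (hu : Close G k u (Q.c s).verts) (hv : Close G l v (Q.c t).verts) (h : Within G r u v)
    (hkl : k + l ≤ 12 * r + 2) : s ≤ t + 2 ∧ t ≤ s + 2 := by
  have hn := hu.near (hv.of_within h)
  constructor <;> by_contra! hlt
  · exact not_near hP hlt hs (by omega) hn.symm
  · exact not_near hP hlt ht (by omega) hn

/-- The vertices of the shortest paths joining close components `t` and `t + 1`. -/
def bridge (Q : MinChain P r) (t : ℕ) : Set V :=
  {u | t < Q.m ∧ ∃ k l, k + l ≤ 2 * r ∧ Close G k u (Q.c t).verts ∧ Close G l u (Q.c (t + 1)).verts}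

/-- The vertices of the shortest paths joining components `q`, `q + 1`, `q + 2` to a centre. -/
def star (Q : MinChain P r) (q : ℕ) : Set V :=
  {u | ∃ z, Q.IsCentre q z ∧ Within G (3 * r) z u ∧
    ∃ t ∈ Set.Icc q (q + 2), Close G (3 * r) u (Q.c t).verts}

/-- The component `t` together with its connections to the next components on its side. -/
def piece (Q : MinChain P r) (t : ℕ) : Set V := (Q.c t).verts ∪ Q.bridge t ∪ Q.star t

theorem side_succ_of_mem_bridge (hu : u ∈ Q.bridge t) : Q.side (t + 1) = Q.side t := by
  obtain ⟨-, k, l, hkl, h₁, h₂⟩ := hu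
  exact side_succ_of_merges (.inl ((h₁.near h₂).mono hkl))

theorem close_of_mem_bridge (hu : u ∈ Q.bridge t) :
    Close G (2 * r) u (Q.c t).verts ∧ Close G (2 * r) u (Q.c (t + 1)).verts := by
  obtain ⟨-, k, l, hkl, h₁, h₂⟩ := hu
  exact ⟨h₁.mono (by omega), h₂.mono (by omega)⟩

theorem exists_close_of_mem_bridge (hu : u ∈ Q.bridge t) :
    ∃ s ≤ Q.m, Q.side s = Q.side t ∧ Close G r u (Q.c s).verts := by
  have hside := side_succ_of_mem_bridge hu
  obtain ⟨ht, k, l, hkl, h₁, h₂⟩ := hu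
  rcases le_or_gt k r with hk | hk
  · exact ⟨t, ht.le, rfl, h₁.mono hk⟩
  · exact ⟨t + 1, ht, hside, h₂.mono (by omega)⟩

theorem close_of_mem_star (hu : u ∈ Q.star q) (ht : t ∈ Set.Icc q (q + 2)) :
    Close G (6 * r) u (Q.c t).verts := by
  obtain ⟨z, hz, hzu, -⟩ := hu
  exact ((hz.2 t ht).of_within hzu.symm).mono (by omega)

theorem close_of_mem_piece (hu : u ∈ Q.piece t) : Close G (6 * r) u (Q.c t).verts := by
  rcases hu with (hu | hu) | hu
  · exact .of_mem _ hu
  · exact (close_of_mem_bridge hu).1.mono (by omega)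
  · exact close_of_mem_star hu ⟨le_rfl, by omega⟩

theorem not_within_of_mem_piece_of_mem_Icc (hu : u ∈ Q.piece t) (hi : i ∈ Set.Icc 0 P.n) :
    ¬ Within G r u (P.p i) := by
  obtain ⟨s, hs⟩ : ∃ s, Close G (3 * r) u (Q.c s).verts := by
    rcases hu with (hu | hu) | ⟨-, -, -, s, -, hs⟩
    · exact ⟨t, .of_mem _ hu⟩
    · obtain ⟨s, -, -, hs⟩ := exists_close_of_mem_bridge hu
      exact ⟨s, hs.mono (by omega)⟩
    · exact ⟨s, hs⟩
  exact not_within_of_close_verts hs hi (by omega)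

/-- A star is close to three consecutive components on its side, so by `index_le_of_close` no
component on the other side has an index that would allow it to be near. -/
theorem not_within_of_mem_star (hP : P.Bypassed r) (ht : t ≤ Q.m) (hu : u ∈ Q.star q)
    (hv : Close G k v (Q.c t).verts) (hk : k ≤ 6 * r + 2) (hne : Q.side q ≠ Q.side t) :
    ¬ Within G r u v := by
  intro h
  obtain ⟨z, hz, -⟩ := id hu
  have h₀ := index_le_of_close hP (s := q) (by have := hz.1; omega) ht
    (close_of_mem_star hu ⟨le_rfl, by omega⟩) hv h (by omega)
  have h₂ := index_le_of_close hP hz.1 ht (close_of_mem_star hu ⟨by omega, le_rfl⟩) hv h (by omega)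
  exact hne (hz.side_eq ⟨by omega, by omega⟩).symm

theorem not_within_of_mem_bridge_of_mem_verts (ht : t ≤ Q.m) (hu : u ∈ Q.bridge s)
    (hv : v ∈ (Q.c t).verts) (hne : Q.side s ≠ Q.side t) : ¬ Within G r u v := by
  intro h
  obtain ⟨s', hs', hside, hc⟩ := exists_close_of_mem_bridge hu
  exact not_near_of_side_ne hs' ht (hside ▸ hne)
    ((hc.near ((Close.of_mem 0 hv).of_within h)).mono (by omega))

theorem not_within_of_mem_bridge (hP : P.Bypassed r) (hu : u ∈ Q.bridge s) (hv : v ∈ Q.bridge t)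
    (hne : Q.side s ≠ Q.side t) : ¬ Within G r u v := by
  intro h
  have ⟨hu₀, hu₁⟩ := close_of_mem_bridge hu
  have ⟨hv₀, hv₁⟩ := close_of_mem_bridge hv
  have h₁ := index_le_of_close hP hu.1.le hv.1 hu₀ hv₁ h (by omega)
  have h₂ := index_le_of_close hP hu.1 hv.1.le hu₁ hv₀ h (by omega)
  obtain rfl | rfl | rfl : s = t ∨ s = t + 1 ∨ t = s + 1 := by omega
  · exact hne rfl
  · exact hne (side_succ_of_mem_bridge hv)
  · exact hne (side_succ_of_mem_bridge hu).symm

theorem not_within_of_mem_piece (hP : P.Bypassed r) (hs : s ≤ Q.m) (ht : t ≤ Q.m)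
    (hu : u ∈ Q.piece s) (hv : v ∈ Q.piece t) (hne : Q.side s ≠ Q.side t) : ¬ Within G r u v := by
  intro h
  have huc := close_of_mem_piece hu
  have hvc := close_of_mem_piece hv
  rcases hu with (hu | hu) | hu
  · rcases hv with (hv | hv) | hv
    · exact not_near_of_side_ne hs ht hne ⟨u, hu, v, hv, h.mono (by omega)⟩
    · exact not_within_of_mem_bridge_of_mem_verts hs hv hu hne.symm h.symm
    · exact not_within_of_mem_star hP hs hv huc (by omega) hne.symm h.symm
  · rcases hv with (hv | hv) | hv
    · exact not_within_of_mem_bridge_of_mem_verts ht hu hv hne h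
    · exact not_within_of_mem_bridge hP hu hv hne h
    · exact not_within_of_mem_star hP hs hv huc (by omega) hne.symm h.symm
  · exact not_within_of_mem_star hP ht hu hvc (by omega) hne h

/-- A bridge near a component just before or just after it contains a centre, which puts that
component on the side of the bridge. -/
theorem side_eq_of_close_of_mem_bridge (hP : P.Bypassed r) (hs : s ≤ Q.m) (hv : v ∈ Q.bridge t)
    (hvs : Close G (3 * r) v (Q.c s).verts) : Q.side s = Q.side t := by
  have ⟨hv₀, hv₁⟩ := close_of_mem_bridge hv
  have h₀ := index_le_of_close hP hs hv.1.le hvs hv₀ (.refl r v) (by omega)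
  have h₁ := index_le_of_close hP hs hv.1 hvs hv₁ (.refl r v) (by omega)
  have hcentre : ∀ q, q + 2 ≤ Q.m → (∀ j ∈ Set.Icc q (q + 2), j = t ∨ j = t + 1 ∨ j = s) →
      Q.IsCentre q v := by
    refine fun q hq hj => ⟨hq, fun j hjq => ?_⟩
    obtain rfl | rfl | rfl := hj j hjq
    exacts [hv₀.mono (by omega), hv₁.mono (by omega), hvs]
  have ht := hv.1
  obtain rfl | rfl | rfl | rfl : s = t ∨ s = t + 1 ∨ t = s + 1 ∨ s = t + 2 := by omega
  · rfl
  · exact side_succ_of_mem_bridge hv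
  · exact ((hcentre s (by omega) fun j ⟨_, _⟩ => by omega).side_eq ⟨by omega, by omega⟩).symm
  · exact (hcentre t hs fun j ⟨_, _⟩ => by omega).side_eq ⟨by omega, le_rfl⟩

namespace Turns

variable {R : Q.Turns}

/-- The stretch of the spine that ends at the turn `t`, with the shortest paths attaching it to
components on the other side than `t`. -/
def trunk (R : Q.Turns) (t : ℕ) : Set V :=
  {u | ∃ i ∈ Set.uIcc (R.head t) (R.a t), u = P.p i ∨
    ∃ s ≤ Q.m, Q.side s ≠ Q.side t ∧
      ∃ k l, k + l ≤ 4 * r + 1 ∧ Within G k (P.p i) u ∧ Close G l u (Q.c s).verts}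

theorem exists_within_of_mem_trunk (hu : u ∈ R.trunk t) :
    ∃ i ∈ Set.uIcc (R.head t) (R.a t), Within G (4 * r + 1) (P.p i) u := by
  obtain ⟨i, hi, rfl | ⟨s, -, -, k, l, hkl, hk, -⟩⟩ := hu
  · exact ⟨i, hi, .refl _ _⟩
  · exact ⟨i, hi, hk.mono (by omega)⟩

theorem not_within_of_mem_trunk (hP : P.Bypassed r) (hs : Q.IsTurn s) (ht : Q.IsTurn t)
    (hu : u ∈ R.trunk s) (hv : v ∈ R.trunk t) (hne : s ≠ t) : ¬ Within G r u v := by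
  intro h
  wlog hst : s < t generalizing s t u v
  · exact this ht hs hv hu hne.symm h.symm (by omega)
  obtain ⟨i, hi, hiu⟩ := exists_within_of_mem_trunk hu
  obtain ⟨j, hj, hjv⟩ := exists_within_of_mem_trunk hv
  have := add_le_of_mem_uIcc hP hst hs ht hi hj
  have := P.le_add_of_within (mem_Icc_of_mem_uIcc hs hi) (mem_Icc_of_mem_uIcc ht hj)
    ((hiu.trans h).trans hjv.symm)
  omega

/-- The part of the attaching path that is near a component or a bridge is far from the spine, hence
near the component to which the path leads. -/
theorem not_within_of_mem_trunk_of_mem_piece (hP : P.Bypassed r) (ht : Q.IsTurn t) (hs : s ≤ Q.m)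
    (hu : u ∈ R.trunk t) (hv : v ∈ Q.piece s) (hside : Q.side t = Q.side s) :
    ¬ Within G r u v := by
  intro h
  obtain ⟨i, hi, rfl | ⟨j, hj, hne, k, l, hkl, hk, hl⟩⟩ := hu <;>
    replace hi := mem_Icc_of_mem_uIcc ht hi
  · exact not_within_of_mem_piece_of_mem_Icc hv hi h.symm
  rw [hside] at hne
  have hlow : ∀ {k' : ℕ} {C : FarComp P r}, Close G k' v C.verts → 4 * r < k' + (k + r) :=
    fun hc => not_le.1 fun hle => not_within_of_close_verts hc hi hle (hk.trans h).symm
  rcases hv with (hv | hv) | hv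
  · have := hlow (.of_mem 0 hv)
    exact not_near_of_side_ne hj hs hne
      ((hl.near ((Close.of_mem 0 hv).of_within h)).mono (by omega))
  · obtain ⟨_, -, -, hc⟩ := exists_close_of_mem_bridge hv
    have := hlow hc
    exact hne (side_eq_of_close_of_mem_bridge hP hj hv ((hl.of_within h.symm).mono (by omega)))
  · exact not_within_of_mem_star hP hj hv hl (by omega) hne.symm h.symm

/-- The vertices available to the path on side `e`: the pieces on that side, and the trunks along
the components on the other side. -/
def half (R : Q.Turns) (e : Bool) : Set V :=
  {u | (∃ t ≤ Q.m, Q.side t = e ∧ u ∈ Q.piece t) ∨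
    ∃ t, Q.IsTurn t ∧ Q.side t = !e ∧ u ∈ R.trunk t}

theorem not_within_of_mem_half (hP : P.Bypassed r) {e : Bool} (hu : u ∈ R.half e)
    (hv : v ∈ R.half !e) : ¬ Within G r u v := by
  intro h
  rcases hu with ⟨s, hs, hse, hu⟩ | ⟨s, hs, hse, hu⟩ <;>
    rcases hv with ⟨t, ht, hte, hv⟩ | ⟨t, ht, hte, hv⟩
  · exact not_within_of_mem_piece hP hs ht hu hv (by simp [hse, hte]) h
  · exact not_within_of_mem_trunk_of_mem_piece hP ht hs hv hu (by simp [hse, hte]) h.symm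
  · exact not_within_of_mem_trunk_of_mem_piece hP hs ht hu hv (by simp [hse, hte]) h
  · refine not_within_of_mem_trunk hP hs ht hu hv ?_ h
    rintro rfl
    simp [hse] at hte

theorem piece_subset_half (ht : t ≤ Q.m) : Q.piece t ⊆ R.half (Q.side t) :=
  fun _ hu => .inl ⟨t, ht, rfl, hu⟩

theorem trunk_subset_half (ht : Q.IsTurn t) : R.trunk t ⊆ R.half !Q.side t :=
  fun _ hu => .inr ⟨t, ht, by simp, hu⟩

theorem reachableIn_half_of_mem_verts (ht : t ≤ Q.m) (hu : u ∈ (Q.c t).verts)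
    (hv : v ∈ (Q.c t).verts) : ReachableIn G (R.half (Q.side t)) u v :=
  (FarComp.reachableIn_verts hu hv).mono fun _ hz => piece_subset_half ht (.inl (.inl hz))

theorem exists_reachableIn_half_of_isCentre {z : V} (hz : Q.IsCentre q z)
    (ht : t ∈ Set.Icc q (q + 2)) :
    ∃ y ∈ (Q.c t).verts, ReachableIn G (R.half (Q.side q)) z y := by
  obtain ⟨y, hy, hzy⟩ := hz.2 t ht
  refine ⟨y, hy, hzy.reachableIn.mono fun u ⟨k, l, hkl, hzu, huy⟩ => ?_⟩
  have hq := hz.1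
  exact piece_subset_half (by omega)
    (.inr ⟨z, hz, hzu.mono (by omega), t, ht, y, hy, huy.mono (by omega)⟩)

theorem exists_reachableIn_half_of_merges (R : Q.Turns) (ht : t < Q.m) (h : Q.Merges t) :
    ∃ x ∈ (Q.c t).verts, ∃ y ∈ (Q.c (t + 1)).verts, ReachableIn G (R.half (Q.side t)) x y := by
  rcases h with ⟨x, hx, y, hy, hxy⟩ | ⟨q, z, hqt, htq, hz⟩
  · refine ⟨x, hx, y, hy, hxy.reachableIn.mono fun u ⟨k, l, hkl, hxu, huy⟩ => ?_⟩
    exact piece_subset_half ht.le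
      (.inl (.inr ⟨ht, k, l, hkl, ⟨x, hx, hxu.symm⟩, y, hy, huy⟩))
  · rw [hz.side_eq ⟨hqt, by omega⟩]
    obtain ⟨x, hx, hzx⟩ := exists_reachableIn_half_of_isCentre (R := R) hz (t := t)
      ⟨hqt, by omega⟩
    obtain ⟨y, hy, hzy⟩ := exists_reachableIn_half_of_isCentre (R := R) hz (t := t + 1)
      ⟨by omega, by omega⟩
    exact ⟨x, hx, y, hy, hzx.symm.trans hzy⟩

theorem exists_reachableIn_trunk (hs : s ≤ Q.m) (hne : Q.side s ≠ Q.side t)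
    (hi : i ∈ Set.uIcc (R.head t) (R.a t)) (hi' : i ∈ Set.Icc 0 P.n) (ha : i ∈ (Q.c s).att) :
    ∃ y ∈ (Q.c s).verts, ReachableIn G (R.trunk t) (P.p i) y := by
  obtain ⟨hi0, hin⟩ := hi'
  obtain ⟨-, y, hy, hiy⟩ | ⟨h, -⟩ | ⟨h, -⟩ := ha
  · refine ⟨y, hy, hiy.reachableIn.mono fun u ⟨k, l, hkl, hiu, huy⟩ => ?_⟩
    exact ⟨i, hi, .inr ⟨s, hs, hne, k, l, hkl, hiu, y, hy, huy⟩⟩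
  · omega
  · omega

theorem reachableIn_half_head_a (ht : Q.IsTurn t) :
    ReachableIn G (R.half !Q.side t) (P.p (R.head t)) (P.p (R.a t)) :=
  P.reachableIn_uIcc (R.head_mem_Icc ht.1) (a_mem_Icc_of_isTurn ht) fun i hi =>
    trunk_subset_half ht ⟨i, hi, .inl rfl⟩

theorem head_mem_half (R : Q.Turns) (ht : t ≤ Q.m) : P.p (R.head t) ∈ R.half !Q.side t := by
  obtain ⟨s, hs, hhead, hside⟩ := R.exists_isTurn ht
  rw [← hhead, ← hside]
  exact trunk_subset_half hs ⟨_, Set.left_mem_uIcc, .inl rfl⟩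

theorem exists_reachableIn_half_of_head (R : Q.Turns) (ht : t < Q.m) (h : ¬ Q.Merges t) :
    ∃ y ∈ (Q.c (t + 1)).verts, ReachableIn G (R.half !Q.side t) (P.p (R.head t)) y := by
  have hturn : Q.IsTurn t := ⟨ht.le, fun _ => h⟩
  obtain ⟨y, hy, hay⟩ := exists_reachableIn_trunk (R := R) ht
    (by simp [side_succ_of_not_merges h]) Set.right_mem_uIcc (R.a_mem_Icc ht h) (R.mem_a t ht h)
  exact ⟨y, hy, (reachableIn_half_head_a hturn).trans (hay.mono (trunk_subset_half hturn))⟩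

theorem exists_reachableIn_half_head_succ (R : Q.Turns) (ht : t < Q.m) (h : ¬ Q.Merges t) :
    ∃ x ∈ (Q.c t).verts, ReachableIn G (R.half (Q.side t)) x (P.p (R.head (t + 1))) := by
  obtain ⟨s, hs, hhead, hside⟩ := R.exists_isTurn ht
  rw [side_succ_of_not_merges h] at hside
  rw [head_succ_of_not_merges h] at hhead ⊢
  obtain ⟨x, hx, hbx⟩ := exists_reachableIn_trunk (R := R) (t := s) ht.le (by simp [hside])
    (hhead ▸ Set.left_mem_uIcc) (R.b_mem_Icc ht h) (R.mem_b t ht h)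
  have := hbx.symm.mono (trunk_subset_half hs)
  rw [hside, Bool.not_not] at this
  exact ⟨x, hx, this⟩

theorem exists_reachableIn_half (R : Q.Turns) (ht : t ≤ Q.m) :
    (∃ s ∈ S, ∀ v ∈ (Q.c t).verts, ReachableIn G (R.half (Q.side t)) s v) ∧
      ∃ s ∈ S, ReachableIn G (R.half !Q.side t) s (P.p (R.head t)) := by
  induction t with
  | zero =>
    obtain ⟨s, hs, hsS⟩ := Q.meets_S
    exact ⟨⟨s, hsS, fun v hv => reachableIn_half_of_mem_verts ht hs hv⟩,
      _, P.mem_S, .refl (R.head_mem_half ht)⟩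
  | succ t ih =>
    obtain ⟨⟨s, hs, hsv⟩, s', hs', hhead⟩ := ih (by omega)
    have hcomp : ∀ {y v}, y ∈ (Q.c (t + 1)).verts → v ∈ (Q.c (t + 1)).verts →
      ReachableIn G (R.half (Q.side (t + 1))) y v := reachableIn_half_of_mem_verts ht
    by_cases h : Q.Merges t
    · obtain ⟨x, hx, y, hy, hxy⟩ := R.exists_reachableIn_half_of_merges ht h
      rw [side_succ_of_merges h] at hcomp ⊢
      rw [head_succ_of_merges h]
      exact ⟨⟨s, hs, fun v hv => ((hsv x hx).trans hxy).trans (hcomp hy hv)⟩, s', hs', hhead⟩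
    · obtain ⟨y, hy, hhy⟩ := R.exists_reachableIn_half_of_head ht h
      obtain ⟨x, hx, hxh⟩ := R.exists_reachableIn_half_head_succ ht h
      rw [side_succ_of_not_merges h] at hcomp ⊢
      rw [Bool.not_not]
      exact ⟨⟨s', hs', fun v hv => (hhead.trans hhy).trans (hcomp hy hv)⟩,
        s, hs, (hsv x hx).trans hxh⟩

theorem exists_pathBetween_subset_half (R : Q.Turns) (e : Bool) :
    ∃ A : PathBetween G S T, A.verts ⊆ R.half e := by
  obtain ⟨⟨s, hs, hsv⟩, s', hs', hhead⟩ := R.exists_reachableIn_half le_rfl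
  obtain rfl | rfl := Bool.eq_or_eq_not e (Q.side Q.m)
  · obtain ⟨v, hv, hvT⟩ := Q.meets_T
    exact (hsv v hv).exists_pathBetween hs hvT
  · have hturn : Q.IsTurn Q.m := ⟨le_rfl, fun h => absurd h (lt_irrefl _)⟩
    exact (hhead.trans (reachableIn_half_head_a hturn)).exists_pathBetween hs'
      (R.a_m ▸ P.mem_T)

end Turns

end MinChain

theorem Bypassed.exists_distant_paths (hP : P.Bypassed r) :
    ∃ A B : PathBetween G S T, r < setDist G A.verts B.verts := by
  obtain ⟨Q⟩ := hP.exists_minChain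
  obtain ⟨R⟩ := Q.exists_turns
  obtain ⟨A, hA⟩ := R.exists_pathBetween_subset_half true
  obtain ⟨B, hB⟩ := R.exists_pathBetween_subset_half false
  exact ⟨A, B, lt_setDist fun x hx y hy =>
    MinChain.Turns.not_within_of_mem_half hP (hA hx) (hB hy)⟩

end Spine

end CoarseMenger

open CoarseMenger in
theorem theorem3p4_general {V : Type*} [Nonempty V] (G : SimpleGraph V) (S T : Set V) (r : ℕ) :
    (∃ P Q : PathBetween G S T, r < setDist G P.verts Q.verts) ∨
      ∃ x : V, ∀ P : PathBetween G S T, ∃ v ∈ P.verts, G.edist v x ≤ (43 * r + 8 : ℕ) := by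
  rw [or_iff_not_imp_right]
  intro hball
  push Not at hball
  obtain ⟨A, -⟩ := hball (Classical.arbitrary V)
  obtain ⟨P⟩ := exists_spine A
  refine Spine.Bypassed.exists_distant_paths (P := P) fun i hi => ?_
  obtain ⟨A, hA⟩ := hball (P.p i)
  exact Spine.exists_bypasses hi A fun z hz => (hA z hz).not_ge

theorem theorem3p4 {V : Type*} [Nonempty V] (G : SimpleGraph V) (S T : Set V) :
    (∃ P Q : PathBetween G S T, 3 ≤ setDist G P.verts Q.verts) ∨
      ∃ x : V, ∀ P : PathBetween G S T, ∃ v ∈ P.verts, G.edist v x ≤ 161 :=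
  (theorem3p4_general G S T 2).imp (fun ⟨P, Q, h⟩ => ⟨P, Q, ENat.natCast_add_one_le_iff.2 h⟩)
    fun ⟨x, h⟩ => ⟨x, fun P => (h P).imp fun _ ⟨hv, hvx⟩ => ⟨hv, hvx.trans (by norm_num)⟩⟩
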